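/- Let $\mu_1,\dots,\mu_N\in\mathbf C$ be distinct, let $X\subset \mathrm P^{N-1}$ be the intersection of the quadrics $q=\sum_i x_i^2=0$ and $q_1=\sum_i\mu_ix_i^2=0$, and let $x=(x_1,\dots,x_N)\neq 0$ span the line $L\subset\mathbf C^N$ of a point of $X$. Put $$\mathcal T=\Big\{u\in\mathbf C^N:\ \sum_i x_iu_i=\sum_i\mu_ix_iu_i=0\Big\}\supset L,$$ so that $\mathcal T/L\cong L\otimes T_xX$. Let $y\in\mathbf C^N$ satisfy $\sum_i x_iy_i=0$; it represents the cotangent vector $u\mapsto\sum_i y_iu_i$ to $X$ at $x$, and every cotangent vector has such a representative. Assume that this cotangent vector is nonzero, i.e. does not vanish identically on $\mathcal T$. On $\mathrm P^1$ with affine coordinate $z$ and canonical bundle $K$, the pencil $zq-q_1$ gives the symmetric form $\sum_i(z-\mu_i)u_iv_i$ on $\mathcal O^N$ with values in $\mathcal O(1)$. Let $L^\perp\subset\mathcal O^N$ be the subbundle orthogonal to $L$ for this form, let $W=L^\perp/L$ with the induced form, and let $T\subset W$ be the trivial subbundle with fibre $\mathcal T/L$. Let $U\subset T$ be the trivial subbundle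 whose fibre is the annihilator $\{u\in\mathcal T:\sum_iy_iu_i=0\}/L$ of the cotangent vector. The matrix $$A_{ij}=\frac{x_iy_j-y_ix_j}{z-\mu_i}$$ maps $\mathcal O^N$ meromorphically to $L^\perp$ and annihilates $L$, so it induces a meromorphic endomorphism $A$ of $W$; it annihilates $U$, so it induces a meromorphic endomorphism of $W/U$ and a Higgs field $\Psi=A\,dz:W/U\to W/U\otimes K$ (with poles). On the other side, let $e_1,e_2$ be a basis of $\mathbf C^2$ with skew form $\langle e_1,e_2\rangle=1$, let $v_i=x_ie_1+y_ie_2$, and let $v\otimes v$ denote the endomorphism $w\mapsto\langle v,w\rangle v$. Let $E=\mathcal O(-1)\,e_1\oplus\mathcal O\,e_2$ be the bundle whose sections are the sections of the trivial bundle $\mathbf C^2\otimes\mathcal O$ with value at $z=\infty$ in the line spanned by $e_2$, with the meromorphic (Garnier/Gaudin) Higgs field $$\Phi=\sum_{i=1}^N\frac{v_i\otimes v_i}{z-\mu_i}\,dz .$$ Then: 1. $W$ has rank $N-2$, and $A:W\to W$ depends only on the cotangent vector and not on its representative $y$. 2. $A$ is skew-adjoint for the form on $W$, it has rank $2$, and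 $A\,dz$ is a Higgs field $W\to W\otimes K(D)$, $D=\mu_1+\dots+\mu_N$: it has at most simple poles at the points $z=\mu_i$ and no other poles, $z=\infty$ included. 3. $U$ is the intersection of $T$ with the kernel of $A$, and $W/U$ has rank $2$. 4. $(W/U,\Psi)$ is equivalent to $(E,\Phi)$: there is an isomorphism of vector bundles $W/U\cong E$ on $\mathrm P^1$ which carries $\Psi$ to $\Phi$. -/

import Mathlib

open scoped TensorProduct KaehlerDifferential

namespace PencilHiggs

noncomputable section

/-! ### Algebraic vector bundles on the projective line

The field of meromorphic functions on `ℙ¹` is `ℂ(z)`; the functions regular on the chart `z ≠ ∞`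
form `ℂ[z]`, those regular on the chart `z ≠ 0` form `ℂ[z⁻¹]`. -/

/-- Meromorphic functions on `ℙ¹`. -/
abbrev MeroFun : Type := RatFunc ℂ

/-- The affine coordinate on `ℙ¹`. -/
abbrev zz : MeroFun := RatFunc.X

/-- The constant function with value `a`. -/
abbrev cst (a : ℂ) : MeroFun := algebraMap ℂ MeroFun a

/-- `ℂ[z]`. -/
def regFin : Subalgebra ℂ MeroFun := Algebra.adjoin ℂ {zz}

/-- `ℂ[z⁻¹]`. -/
def regInf : Subalgebra ℂ MeroFun := Algebra.adjoin ℂ {zz⁻¹}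

/-- An algebraic vector bundle on `ℙ¹`: its space `Gen` of meromorphic sections, the `ℂ[z]`-module
of sections over `z ≠ ∞` and the `ℂ[z⁻¹]`-module of sections over `z ≠ 0`.  Both are finitely
generated (and torsion-free over a principal ideal domain, hence free), they span `Gen`, and they
have the same localization over the overlap of the two charts. -/
structure P1Bundle where
  Gen : Type
  [instAddCommGroup : AddCommGroup Gen]
  [instModule : Module MeroFun Gen]
  secFin : Submodule regFin Gen
  secInf : Submodule regInf Gen
  fg_fin : secFin.FG
  fg_inf : secInf.FG
  span_fin : Submodule.span MeroFun (secFin : Set Gen) = ⊤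
  span_inf : Submodule.span MeroFun (secInf : Set Gen) = ⊤
  glue : ∀ u : Gen, (∃ n : ℕ, zz ^ n • u ∈ secFin) ↔ (∃ n : ℕ, zz⁻¹ ^ n • u ∈ secInf)

attribute [instance] P1Bundle.instAddCommGroup P1Bundle.instModule

/-- The rank of a bundle. -/
def P1Bundle.rank (E : P1Bundle) : ℕ := Module.finrank MeroFun E.Gen

/-- Isomorphisms of vector bundles on `ℙ¹`: isomorphisms of the spaces of meromorphic sections that
match the regular sections over both charts. -/
structure P1Bundle.Iso (E F : P1Bundle) where
  toEquiv : E.Gen ≃ₗ[MeroFun] F.Gen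
  map_fin : ∀ u, u ∈ E.secFin ↔ toEquiv u ∈ F.secFin
  map_inf : ∀ u, u ∈ E.secInf ↔ toEquiv u ∈ F.secInf

theorem zz_ne_zero : zz ≠ 0 := RatFunc.X_ne_zero

theorem zz_mem : zz ∈ regFin := Algebra.subset_adjoin rfl

theorem zz_inv_mem : zz⁻¹ ∈ regInf := Algebra.subset_adjoin rfl

instance : IsNoetherianRing regFin := by
  have : Algebra.FiniteType ℂ (Algebra.adjoin ℂ ({zz} : Set MeroFun)) :=
    (Subalgebra.fg_iff_finiteType _).mp ⟨{zz}, by simp⟩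
  exact Algebra.FiniteType.isNoetherianRing ℂ (Algebra.adjoin ℂ ({zz} : Set MeroFun))

instance : IsNoetherianRing regInf := by
  have : Algebra.FiniteType ℂ (Algebra.adjoin ℂ ({zz⁻¹} : Set MeroFun)) :=
    (Subalgebra.fg_iff_finiteType _).mp ⟨{zz⁻¹}, by simp⟩
  exact Algebra.FiniteType.isNoetherianRing ℂ (Algebra.adjoin ℂ ({zz⁻¹} : Set MeroFun))

/-- If `A = ℂ[t]`, then every element of `A` is, up to a power of `t`, an element of `ℂ[t⁻¹]`. -/
theorem exists_pow_mul_mem {t : MeroFun} (ht : t ≠ 0) {f : MeroFun}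
    (hf : f ∈ Algebra.adjoin ℂ ({t} : Set MeroFun)) :
    ∃ n : ℕ, ∀ m, n ≤ m → t⁻¹ ^ m * f ∈ Algebra.adjoin ℂ ({t⁻¹} : Set MeroFun) := by
  have hin : t⁻¹ ∈ Algebra.adjoin ℂ ({t⁻¹} : Set MeroFun) := Algebra.subset_adjoin rfl
  induction hf using Algebra.adjoin_induction with
  | mem x hx =>
    obtain rfl : x = t := hx
    refine ⟨1, fun m hm => ?_⟩
    obtain ⟨k, rfl⟩ := Nat.exists_eq_add_of_le hm
    have : x⁻¹ ^ (1 + k) * x = x⁻¹ ^ k := by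
      rw [pow_add, pow_one, mul_comm, ← mul_assoc, mul_inv_cancel₀ ht, one_mul]
    rw [this]
    exact pow_mem hin k
  | algebraMap r => exact ⟨0, fun m _ => mul_mem (pow_mem hin m) (Subalgebra.algebraMap_mem _ r)⟩
  | add a b _ _ ha hb =>
    obtain ⟨n, hn⟩ := ha
    obtain ⟨k, hk⟩ := hb
    refine ⟨max n k, fun m hm => ?_⟩
    rw [mul_add]
    exact add_mem (hn m (le_trans (le_max_left _ _) hm)) (hk m (le_trans (le_max_right _ _) hm))
  | mul a b _ _ ha hb =>
    obtain ⟨n, hn⟩ := ha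
    obtain ⟨k, hk⟩ := hb
    refine ⟨n + k, fun m hm => ?_⟩
    obtain ⟨l, rfl⟩ := Nat.exists_eq_add_of_le hm
    have : t⁻¹ ^ (n + k + l) * (a * b) = (t⁻¹ ^ n * a) * (t⁻¹ ^ (k + l) * b) := by ring
    rw [this]
    exact mul_mem (hn n le_rfl) (hk _ (Nat.le_add_right _ _))

theorem exists_pow_mul_mem_inf {f : MeroFun} (hf : f ∈ regFin) :
    ∃ n : ℕ, ∀ m, n ≤ m → zz⁻¹ ^ m * f ∈ regInf :=
  exists_pow_mul_mem zz_ne_zero hf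

theorem exists_pow_mul_mem_fin {f : MeroFun} (hf : f ∈ regInf) :
    ∃ n : ℕ, ∀ m, n ≤ m → zz ^ m * f ∈ regFin := by
  have := exists_pow_mul_mem (inv_ne_zero zz_ne_zero) hf
  rwa [inv_inv] at this

theorem exists_den_fin (f : MeroFun) : ∃ d ∈ regFin, d ≠ 0 ∧ d * f ∈ regFin := by
  have hp : ∀ p : Polynomial ℂ, algebraMap (Polynomial ℂ) MeroFun p ∈ regFin := by
    intro p
    induction p using Polynomial.induction_on' with
    | add p q hp hq => rw [map_add]; exact add_mem hp hq
    | monomial n a =>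
      rw [← Polynomial.C_mul_X_pow_eq_monomial, map_mul, map_pow, RatFunc.algebraMap_X,
        RatFunc.algebraMap_C]
      exact mul_mem (Subalgebra.algebraMap_mem regFin a) (pow_mem zz_mem n)
  have hd : algebraMap (Polynomial ℂ) MeroFun f.denom ≠ 0 :=
    RatFunc.algebraMap_ne_zero f.denom_ne_zero
  refine ⟨_, hp f.denom, hd, ?_⟩
  have : algebraMap (Polynomial ℂ) MeroFun f.denom * f
      = algebraMap (Polynomial ℂ) MeroFun f.num := by
    conv_lhs => rw [← RatFunc.num_div_denom f]
    rw [RatFunc.num_div_denom f]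
    nth_rewrite 2 [← RatFunc.num_div_denom f]
    field_simp
  rw [this]
  exact hp _

theorem exists_den_inf (f : MeroFun) : ∃ d ∈ regInf, d ≠ 0 ∧ d * f ∈ regInf := by
  obtain ⟨d, hd, hd0, hdf⟩ := exists_den_fin f
  obtain ⟨n, hn⟩ := exists_pow_mul_mem_inf hd
  obtain ⟨k, hk⟩ := exists_pow_mul_mem_inf hdf
  refine ⟨zz⁻¹ ^ (max n k) * d, hn _ (le_max_left _ _),
    mul_ne_zero (pow_ne_zero _ (inv_ne_zero zz_ne_zero)) hd0, ?_⟩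
  rw [mul_assoc]
  exact hk _ (le_max_right _ _)

section lattice

variable {A : Subalgebra ℂ MeroFun} {V : Type} [AddCommGroup V] [Module MeroFun V]

theorem exists_den_mem (hA : ∀ f : MeroFun, ∃ d ∈ A, d ≠ 0 ∧ d * f ∈ A) (M : Submodule A V)
    (hM : Submodule.span MeroFun (M : Set V) = ⊤) (u : V) : ∃ d ∈ A, d ≠ 0 ∧ d • u ∈ M := by
  have hu : u ∈ Submodule.span MeroFun (M : Set V) := by rw [hM]; trivial
  induction hu using Submodule.span_induction with
  | mem x hx => exact ⟨1, one_mem A, one_ne_zero, by simpa using hx⟩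
  | zero => exact ⟨1, one_mem A, one_ne_zero, by simp⟩
  | add x y _ _ hx hy =>
    obtain ⟨d, hd, hd0, hdx⟩ := hx
    obtain ⟨e, he, he0, hey⟩ := hy
    refine ⟨d * e, mul_mem hd he, mul_ne_zero hd0 he0, ?_⟩
    have h1 : (d * e) • (x + y) = (⟨e, he⟩ : A) • (d • x) + (⟨d, hd⟩ : A) • (e • y) := by
      change _ = e • d • x + d • e • y
      rw [smul_add, smul_smul, smul_smul, mul_comm e d]
    rw [h1]
    exact add_mem (M.smul_mem _ hdx) (M.smul_mem _ hey)
  | smul a x _ hx =>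
    obtain ⟨d, hd, hd0, hdx⟩ := hx
    obtain ⟨e, he, he0, hea⟩ := hA a
    refine ⟨e * d, mul_mem he hd, mul_ne_zero he0 hd0, ?_⟩
    have h1 : (e * d) • a • x = (⟨e * a, hea⟩ : A) • (d • x) := by
      change _ = (e * a) • d • x
      rw [smul_smul, smul_smul]
      congr 1
      ring
    rw [h1]
    exact M.smul_mem _ hdx

theorem fg_comap_subtype [IsNoetherianRing A] (M : Submodule A V) (hM : M.FG)
    (S : Submodule MeroFun V) : (M.comap (S.subtype.restrictScalars A)).FG := by
  have : IsNoetherian A M := isNoetherian_of_fg_of_noetherian M hM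
  refine Submodule.fg_of_fg_map_injective (S.subtype.restrictScalars A) Subtype.val_injective ?_
  exact isNoetherian_submodule.mp this _ (Submodule.map_comap_le _ _)

theorem span_comap_subtype (hA : ∀ f : MeroFun, ∃ d ∈ A, d ≠ 0 ∧ d * f ∈ A) (M : Submodule A V)
    (hM : Submodule.span MeroFun (M : Set V) = ⊤) (S : Submodule MeroFun V) :
    Submodule.span MeroFun (M.comap (S.subtype.restrictScalars A) : Set S) = ⊤ := by
  rw [eq_top_iff]
  intro s _
  obtain ⟨d, _, hd0, hds⟩ := exists_den_mem hA M hM (s : V)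
  have h1 : d • s ∈ Submodule.span MeroFun (M.comap (S.subtype.restrictScalars A) : Set S) :=
    Submodule.subset_span hds
  have h2 := Submodule.smul_mem _ d⁻¹ h1
  rwa [smul_smul, inv_mul_cancel₀ hd0, one_smul] at h2

theorem span_map_mkQ (M : Submodule A V) (hM : Submodule.span MeroFun (M : Set V) = ⊤)
    (S : Submodule MeroFun V) :
    Submodule.span MeroFun (M.map (S.mkQ.restrictScalars A) : Set (V ⧸ S)) = ⊤ := by
  have h1 : (M.map (S.mkQ.restrictScalars A) : Set (V ⧸ S)) = S.mkQ '' (M : Set V) := rfl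
  rw [h1, Submodule.span_image, hM, Submodule.map_top, Submodule.range_mkQ]

theorem glue_map_mkQ {B : Subalgebra ℂ MeroFun} {s t : MeroFun} (hst : s * t = 1)
    (M : Submodule A V) (M' : Submodule B V)
    (h : ∀ u : V, (∃ n : ℕ, s ^ n • u ∈ M) → ∃ n : ℕ, t ^ n • u ∈ M')
    (S : Submodule MeroFun V) (u : V ⧸ S)
    (hu : ∃ n : ℕ, s ^ n • u ∈ M.map (S.mkQ.restrictScalars A)) :
    ∃ n : ℕ, t ^ n • u ∈ M'.map (S.mkQ.restrictScalars B) := by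
  obtain ⟨n, m, hm, hmu⟩ := hu
  have hts : ∀ k : ℕ, t ^ k * s ^ k = 1 := fun k => by rw [← mul_pow, mul_comm, hst, one_pow]
  have hst' : ∀ k : ℕ, s ^ k * t ^ k = 1 := fun k => by rw [← mul_pow, hst, one_pow]
  obtain ⟨k, hk⟩ := h (t ^ n • m) ⟨n, by rw [smul_smul, hst', one_smul]; exact hm⟩
  refine ⟨k, t ^ k • t ^ n • m, hk, ?_⟩
  change S.mkQ (t ^ k • t ^ n • m) = _
  have hmu' : S.mkQ m = s ^ n • u := hmu
  rw [map_smul, map_smul, hmu', smul_smul (t ^ n), hts, one_smul]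

end lattice

/-- The subbundle whose meromorphic sections are `S`: a section is regular if and only if it is
regular as a section of `E`.  Every subbundle arises in this way from exactly one `S`. -/
def P1Bundle.sub (E : P1Bundle) (S : Submodule MeroFun E.Gen) : P1Bundle where
  Gen := S
  secFin := E.secFin.comap (S.subtype.restrictScalars regFin)
  secInf := E.secInf.comap (S.subtype.restrictScalars regInf)
  fg_fin := fg_comap_subtype _ E.fg_fin S
  fg_inf := fg_comap_subtype _ E.fg_inf S
  span_fin := span_comap_subtype exists_den_fin _ E.span_fin S
  span_inf := span_comap_subtype exists_den_inf _ E.span_inf S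
  glue u := E.glue u

/-- The quotient of `E` by its subbundle `E.sub S`. -/
def P1Bundle.quot (E : P1Bundle) (S : Submodule MeroFun E.Gen) : P1Bundle where
  Gen := E.Gen ⧸ S
  secFin := E.secFin.map (S.mkQ.restrictScalars regFin)
  secInf := E.secInf.map (S.mkQ.restrictScalars regInf)
  fg_fin := E.fg_fin.map _
  fg_inf := E.fg_inf.map _
  span_fin := span_map_mkQ _ E.span_fin S
  span_inf := span_map_mkQ _ E.span_inf S
  glue u := ⟨glue_map_mkQ (mul_inv_cancel₀ zz_ne_zero) _ _ (fun v => (E.glue v).1) S u,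
    glue_map_mkQ (inv_mul_cancel₀ zz_ne_zero) _ _ (fun v => (E.glue v).2) S u⟩

section sumO

variable {ι : Type} [Fintype ι] [DecidableEq ι]

/-- The tuples `u` of meromorphic functions such that every `w i * u i` lies in `A`. -/
def twistedLattice (A : Subalgebra ℂ MeroFun) (w : ι → MeroFun) : Submodule A (ι → MeroFun) where
  carrier := {u | ∀ i, w i * u i ∈ A}
  add_mem' ha hb i := by
    rw [Pi.add_apply, mul_add]
    exact add_mem (ha i) (hb i)
  zero_mem' i := by simp
  smul_mem' c u hu i := by
    have : w i * (c • u) i = c * (w i * u i) := by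
      change w i * ((c : MeroFun) * u i) = _
      ring
    rw [this]
    exact mul_mem c.2 (hu i)

theorem twistedLattice_eq (A : Subalgebra ℂ MeroFun) (w : ι → MeroFun) (hw : ∀ i, w i ≠ 0) :
    twistedLattice A w = Submodule.span A (Set.range fun i => Pi.single i (w i)⁻¹) := by
  apply le_antisymm
  · intro u hu
    have : u = ∑ i, (⟨w i * u i, hu i⟩ : A) • (Pi.single i (w i)⁻¹ : ι → MeroFun) := by
      ext j
      rw [Finset.sum_apply, Finset.sum_eq_single j]
      · change u j = (w j * u j) * (Pi.single j (w j)⁻¹ : ι → MeroFun) j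
        rw [Pi.single_eq_same]
        field_simp [hw j]
      · intro b _ hb
        change (w b * u b) * (Pi.single b (w b)⁻¹ : ι → MeroFun) j = 0
        rw [Pi.single_eq_of_ne hb.symm, mul_zero]
      · simp
    rw [this]
    exact sum_mem fun i _ => Submodule.smul_mem _ _ (Submodule.subset_span ⟨i, rfl⟩)
  · rw [Submodule.span_le]
    rintro _ ⟨i, rfl⟩ j
    by_cases h : j = i
    · subst h
      simp only [Pi.single_eq_same, mul_inv_cancel₀ (hw j)]
      exact one_mem A
    · simp only [Pi.single_eq_of_ne h, mul_zero]
      exact zero_mem A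

theorem twistedLattice_fg (A : Subalgebra ℂ MeroFun) (w : ι → MeroFun) (hw : ∀ i, w i ≠ 0) :
    (twistedLattice A w).FG := by
  rw [twistedLattice_eq A w hw]
  exact Submodule.fg_span (Set.finite_range _)

theorem twistedLattice_span (A : Subalgebra ℂ MeroFun) (w : ι → MeroFun) (hw : ∀ i, w i ≠ 0) :
    Submodule.span MeroFun (twistedLattice A w : Set (ι → MeroFun)) = ⊤ := by
  rw [eq_top_iff]
  intro u _
  have : u = ∑ i, (w i * u i) • (Pi.single i (w i)⁻¹ : ι → MeroFun) := by
    ext j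
    rw [Finset.sum_apply, Finset.sum_eq_single j]
    · rw [Pi.smul_apply, Pi.single_eq_same, smul_eq_mul]
      field_simp [hw j]
    · intro b _ hb
      simp [Pi.single_eq_of_ne hb.symm]
    · simp
  rw [this]
  refine sum_mem fun i _ => Submodule.smul_mem _ _ (Submodule.subset_span ?_)
  rw [twistedLattice_eq A w hw]
  exact Submodule.subset_span ⟨i, rfl⟩

/-- The bundle `⨁ i, 𝒪(d i)`: over `z ≠ ∞` a section is a tuple of elements of `ℂ[z]`; at infinity
the `i`-th component may have a pole of order at most `d i` (a zero of order at least `-d i`). -/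
def sumO (d : ι → ℤ) : P1Bundle where
  Gen := ι → MeroFun
  secFin := twistedLattice regFin fun _ => 1
  secInf := twistedLattice regInf fun i => zz ^ (-d i)
  fg_fin := twistedLattice_fg _ _ fun _ => one_ne_zero
  fg_inf := twistedLattice_fg _ _ fun _ => zpow_ne_zero _ zz_ne_zero
  span_fin := twistedLattice_span _ _ fun _ => one_ne_zero
  span_inf := twistedLattice_span _ _ fun _ => zpow_ne_zero _ zz_ne_zero
  glue u := by
    have hz := zz_ne_zero
    constructor
    · rintro ⟨n, hn⟩
      have h1 : ∀ i, ∃ k : ℕ, ∀ m, k ≤ m → zz⁻¹ ^ m * (1 * (zz ^ n • u) i) ∈ regInf :=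
        fun i => exists_pow_mul_mem_inf (hn i)
      choose k hk using h1
      refine ⟨∑ i, (k i + (n + (d i).natAbs)), fun i => ?_⟩
      have hle : k i + (n + (d i).natAbs) ≤ ∑ i, (k i + (n + (d i).natAbs)) :=
        Finset.single_le_sum (f := fun i => k i + (n + (d i).natAbs)) (fun _ _ => Nat.zero_le _)
          (Finset.mem_univ i)
      generalize ∑ i, (k i + (n + (d i).natAbs)) = m at hle
      obtain ⟨l, hl⟩ : ∃ l : ℕ, (l : ℤ) = m + d i + n := ⟨(m + d i + n).toNat, by omega⟩
      have hkl : k i ≤ l := by omega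
      have e1 : zz ^ (-d i) * (zz⁻¹ ^ m • u) i = zz⁻¹ ^ l * (1 * (zz ^ n • u) i) := by
        simp only [Pi.smul_apply, smul_eq_mul, one_mul, ← mul_assoc]
        congr 1
        rw [← zpow_natCast zz⁻¹ m, ← zpow_natCast zz⁻¹ l, ← zpow_natCast zz n, inv_zpow',
          inv_zpow', ← zpow_add₀ hz, ← zpow_add₀ hz]
        congr 1
        omega
      rw [e1]
      exact hk i l hkl
    · rintro ⟨n, hn⟩
      have h1 : ∀ i, ∃ k : ℕ, ∀ m, k ≤ m → zz ^ m * (zz ^ (-d i) * (zz⁻¹ ^ n • u) i) ∈ regFin :=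
        fun i => exists_pow_mul_mem_fin (hn i)
      choose k hk using h1
      refine ⟨∑ i, (k i + (n + (d i).natAbs)), fun i => ?_⟩
      have hle : k i + (n + (d i).natAbs) ≤ ∑ i, (k i + (n + (d i).natAbs)) :=
        Finset.single_le_sum (f := fun i => k i + (n + (d i).natAbs)) (fun _ _ => Nat.zero_le _)
          (Finset.mem_univ i)
      generalize ∑ i, (k i + (n + (d i).natAbs)) = m at hle
      obtain ⟨l, hl⟩ : ∃ l : ℕ, (l : ℤ) = m + d i + n := ⟨(m + d i + n).toNat, by omega⟩
      have hkl : k i ≤ l := by omega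
      have e1 : 1 * (zz ^ m • u) i = zz ^ l * (zz ^ (-d i) * (zz⁻¹ ^ n • u) i) := by
        simp only [Pi.smul_apply, smul_eq_mul, one_mul, ← mul_assoc]
        congr 1
        rw [← zpow_natCast zz⁻¹ n, ← zpow_natCast zz l, ← zpow_natCast zz m, inv_zpow',
          ← zpow_add₀ hz, ← zpow_add₀ hz]
        congr 1
        omega
      rw [e1]
      exact hk i l hkl

end sumO

/-! ### Meromorphic Higgs fields -/

/-- A meromorphic Higgs field on `E`: a meromorphic section of `End E ⊗ K`, that is, an
`𝒪`-linear map from meromorphic sections of `E` to meromorphic `E`-valued differentials. -/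
abbrev MeroHiggs (E : P1Bundle) : Type := E.Gen →ₗ[MeroFun] E.Gen ⊗[MeroFun] Ω[MeroFun⁄ℂ]

/-- The Higgs field `A dz` of a meromorphic endomorphism `A`. -/
def higgsOf (E : P1Bundle) (A : Module.End MeroFun E.Gen) : MeroHiggs E :=
  ((TensorProduct.mk MeroFun E.Gen (Ω[MeroFun⁄ℂ])).flip (KaehlerDifferential.D ℂ MeroFun zz)) ∘ₗ A

/-- Two bundles with meromorphic Higgs fields are equivalent if there is an isomorphism of vector
bundles on `ℙ¹` which intertwines the Higgs fields. -/
def HiggsEquivalent {E F : P1Bundle} (Ψ : MeroHiggs E) (Φ : MeroHiggs F) : Prop :=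
  ∃ e : E.Iso F, ∀ u : E.Gen,
    TensorProduct.map e.toEquiv.toLinearMap LinearMap.id (Ψ u) = Φ (e.toEquiv u)

/-- `A dz` is a regular section of `End E ⊗ K(D)`, where `D` is the divisor of the distinct points
`μ i`: at most simple poles at these points and no pole elsewhere.  Near infinity `dz` has a double
pole, so that `z² A` has to be regular there. -/
def HasSimplePoles {N : ℕ} (μ : Fin N → ℂ) (E : P1Bundle) (A : Module.End MeroFun E.Gen) : Prop :=
  (∀ u ∈ E.secFin, (∏ i, (zz - cst (μ i))) • A u ∈ E.secFin) ∧
  (∀ u ∈ E.secInf, (zz ^ 2 * ∏ i, (1 - cst (μ i) * zz⁻¹)) • A u ∈ E.secInf)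

/-! ### The intersection of two quadrics -/

/-- A point of the smooth intersection `X` of the quadrics `q = ∑ xᵢ²` and `q₁ = ∑ μᵢ xᵢ²` in
`ℙ^(N-1)`, given by a vector `x` of homogeneous coordinates. -/
structure PencilPoint (N : ℕ) where
  μ : Fin N → ℂ
  μ_injective : Function.Injective μ
  x : Fin N → ℂ
  x_ne_zero : x ≠ 0
  q_eq_zero : ∑ i, x i ^ 2 = 0
  q₁_eq_zero : ∑ i, μ i * x i ^ 2 = 0

variable {N : ℕ}

namespace PencilPoint

variable (P : PencilPoint N)

/-- The linear space `{u | ∑ xᵢuᵢ = ∑ μᵢxᵢuᵢ = 0}`.  It contains `x`, and its quotient by the line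
`L` spanned by `x` is `L ⊗ T_x X`. -/
def tangent : Submodule ℂ (Fin N → ℂ) where
  carrier := {u | ∑ i, P.x i * u i = 0 ∧ ∑ i, P.μ i * P.x i * u i = 0}
  add_mem' ha hb := by
    simp only [Set.mem_ofPred_eq, Pi.add_apply, mul_add, Finset.sum_add_distrib] at *
    simp [ha.1, ha.2, hb.1, hb.2]
  zero_mem' := by simp
  smul_mem' c u hu := by
    simp only [Set.mem_ofPred_eq, Pi.smul_apply, smul_eq_mul, mul_left_comm _ c,
      ← Finset.mul_sum] at *
    simp [hu.1, hu.2]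

/-- The bilinear form `∑ (z - μᵢ) uᵢ vᵢ` of the pencil `z q - q₁`; on the bundle `𝒪^N` it takes
values in `𝒪(1)`. -/
def form : LinearMap.BilinForm MeroFun (Fin N → MeroFun) :=
  Matrix.toBilin' (Matrix.diagonal fun i => zz - cst (P.μ i))

/-- The meromorphic sections of the constant line subbundle `L` of `𝒪^N`. -/
def L : Submodule MeroFun (Fin N → MeroFun) := Submodule.span MeroFun {fun i => cst (P.x i)}

/-- The meromorphic sections of `L^⊥ ⊆ 𝒪^N`. -/
def Lperp : Submodule MeroFun (Fin N → MeroFun) := P.form.orthogonal P.L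

/-- The bundle `W = L^⊥ / L`. -/
def W : P1Bundle :=
  ((sumO fun _ : Fin N => 0).sub P.Lperp).quot (P.L.submoduleOf P.Lperp)

/-- The class in `W` of a meromorphic section of `L^⊥`. -/
def toW : P.Lperp →ₗ[MeroFun] P.W.Gen := (P.L.submoduleOf P.Lperp).mkQ

/-- The meromorphic sections of the trivial subbundle `S ⊗ 𝒪` of `𝒪^N`. -/
def constSub (S : Submodule ℂ (Fin N → ℂ)) : Submodule MeroFun (Fin N → MeroFun) :=
  Submodule.span MeroFun ((fun u i => cst (u i)) '' (S : Set (Fin N → ℂ)))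

/-- The trivial subbundle of `W` with fibre `L ⊗ T_x X`. -/
def T : Submodule MeroFun P.W.Gen := ((constSub P.tangent).submoduleOf P.Lperp).map P.toW

theorem form_apply (u v : Fin N → MeroFun) :
    P.form u v = ∑ i, (zz - cst (P.μ i)) * u i * v i := by
  rw [form, Matrix.toBilin'_apply']
  simp only [dotProduct, Matrix.mulVec_diagonal]
  exact Finset.sum_congr rfl fun i _ => by ring

theorem mem_Lperp (u : Fin N → MeroFun) :
    u ∈ P.Lperp ↔ ∑ i, (zz - cst (P.μ i)) * cst (P.x i) * u i = 0 := by
  rw [Lperp, LinearMap.BilinForm.mem_orthogonal_iff]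
  constructor
  · intro h
    rw [← form_apply]
    exact h _ (Submodule.mem_span_singleton_self _)
  · intro h n hn
    obtain ⟨c, rfl⟩ := Submodule.mem_span_singleton.mp hn
    have := P.form_apply (fun i => cst (P.x i)) u
    change P.form _ _ = 0
    rw [map_smul, LinearMap.smul_apply, this, h, smul_zero]

theorem form_comm (u v : Fin N → MeroFun) : P.form u v = P.form v u := by
  rw [form_apply, form_apply]
  exact Finset.sum_congr rfl fun i _ => by ring

/-- The inner product on `W` induced by the pencil. -/
def formW : P.W.Gen →ₗ[MeroFun] P.W.Gen →ₗ[MeroFun] MeroFun :=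
  LinearMap.liftQ₂ (P.L.submoduleOf P.Lperp) (P.L.submoduleOf P.Lperp)
    (P.form.domRestrict₁₂ P.Lperp P.Lperp)
    (by
      intro u hu
      ext v
      exact v.2 u hu)
    (by
      intro v hv
      ext u
      change P.form u v = 0
      rw [form_comm]
      exact u.2 v hv)

end PencilPoint

/-- A vector `y` with `∑ xᵢyᵢ = 0`.  It represents the cotangent vector `u ↦ ∑ yᵢuᵢ` to `X` at the
point `x`, and every cotangent vector has such a representative. -/
structure Covector (P : PencilPoint N) where
  y : Fin N → ℂ
  orth : ∑ i, P.x i * y i = 0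

namespace Covector

variable {P : PencilPoint N} (η : Covector P)

/-- The value of the cotangent vector on `u`. -/
def pairing (u : Fin N → ℂ) : ℂ := ∑ i, η.y i * u i

/-- Two representatives of the same cotangent vector to `X` at `x`. -/
def SameCotangent (η' : Covector P) : Prop := ∀ u ∈ P.tangent, η.pairing u = η'.pairing u

/-- The represented cotangent vector to `X` at `x` does not vanish. -/
def Nonzero : Prop := ∃ u ∈ P.tangent, η.pairing u ≠ 0

/-- The annihilator of the cotangent vector in the tangent space. -/
def ann : Submodule ℂ (Fin N → ℂ) where
  carrier := {u | u ∈ P.tangent ∧ η.pairing u = 0}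
  add_mem' ha hb := by
    refine ⟨add_mem ha.1 hb.1, ?_⟩
    have h1 := ha.2
    have h2 := hb.2
    simp only [pairing] at h1 h2 ⊢
    simp only [Pi.add_apply, mul_add, Finset.sum_add_distrib, h1, h2, add_zero]
  zero_mem' := ⟨zero_mem _, by simp [pairing]⟩
  smul_mem' c u hu := by
    refine ⟨Submodule.smul_mem _ c hu.1, ?_⟩
    have h1 := hu.2
    simp only [pairing] at h1 ⊢
    simp only [Pi.smul_apply, smul_eq_mul, mul_left_comm _ c, ← Finset.mul_sum, h1, mul_zero]

/-- The matrix `A_ij = (x_i y_j - y_i x_j) / (z - μ_i)`. -/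
def matA : Matrix (Fin N) (Fin N) MeroFun :=
  Matrix.of fun i j =>
    (cst (P.x i) * cst (η.y j) - cst (η.y i) * cst (P.x j)) / (zz - cst (P.μ i))

theorem zz_sub_ne_zero (a : ℂ) : zz - cst a ≠ 0 := by
  have h : zz - cst a = algebraMap (Polynomial ℂ) MeroFun (Polynomial.X - Polynomial.C a) := by
    rw [map_sub, RatFunc.algebraMap_X, RatFunc.algebraMap_C]
    rfl
  rw [h]
  exact RatFunc.algebraMap_ne_zero (Polynomial.X_sub_C_ne_zero a)

theorem matA_apply (u : Fin N → MeroFun) (i : Fin N) :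
    Matrix.toLin' η.matA u i = (cst (P.x i) * ∑ j, cst (η.y j) * u j
      - cst (η.y i) * ∑ j, cst (P.x j) * u j) / (zz - cst (P.μ i)) := by
  rw [Matrix.toLin'_apply, Matrix.mulVec, dotProduct, Finset.mul_sum, Finset.mul_sum,
    ← Finset.sum_sub_distrib, Finset.sum_div]
  refine Finset.sum_congr rfl fun j _ => ?_
  simp only [matA, Matrix.of_apply]
  ring

theorem matA_mem (u : Fin N → MeroFun) : Matrix.toLin' η.matA u ∈ P.Lperp := by
  rw [PencilPoint.mem_Lperp]
  have h1 : ∀ i, (zz - cst (P.μ i)) * cst (P.x i) * Matrix.toLin' η.matA u i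
      = cst (P.x i ^ 2) * (∑ j, cst (η.y j) * u j)
        - cst (P.x i * η.y i) * ∑ j, cst (P.x j) * u j := by
    intro i
    have := zz_sub_ne_zero (P.μ i)
    rw [matA_apply, mul_right_comm, mul_div_cancel₀ _ this]
    simp only [cst, map_mul, map_pow]
    ring
  rw [Finset.sum_congr rfl fun i _ => h1 i, Finset.sum_sub_distrib, ← Finset.sum_mul,
    ← Finset.sum_mul]
  simp only [cst]
  rw [← map_sum, ← map_sum, P.q_eq_zero, η.orth]
  simp

theorem matA_eq_zero (u : Fin N → MeroFun) (h1 : ∑ j, cst (P.x j) * u j = 0)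
    (h2 : ∑ j, cst (η.y j) * u j = 0) : Matrix.toLin' η.matA u = 0 := by
  ext i
  rw [matA_apply, h1, h2]
  simp

theorem matA_L (u : Fin N → MeroFun) (hu : u ∈ P.L) : Matrix.toLin' η.matA u = 0 := by
  obtain ⟨c, rfl⟩ := Submodule.mem_span_singleton.mp hu
  rw [map_smul, matA_eq_zero, smul_zero]
  · rw [Finset.sum_congr rfl fun j _ => by rw [← map_mul, ← pow_two], ← map_sum, P.q_eq_zero,
      map_zero]
  · rw [Finset.sum_congr rfl fun j _ => by rw [← map_mul, mul_comm], ← map_sum, η.orth, map_zero]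

/-- The meromorphic endomorphism of `W = L^⊥ / L` induced by the matrix `A`. -/
def A : Module.End MeroFun P.W.Gen :=
  Submodule.mapQ (P.L.submoduleOf P.Lperp) (P.L.submoduleOf P.Lperp)
    ((Matrix.toLin' η.matA).restrict fun u _ => η.matA_mem u)
    (by
      intro u hu
      change Matrix.toLin' η.matA u ∈ P.L
      rw [η.matA_L u hu]
      exact zero_mem _)

/-- The meromorphic sections of the subbundle `U` of `W`, the trivial subbundle whose fibre is the
annihilator of the cotangent vector in `L ⊗ T_x X`. -/
def U : Submodule MeroFun P.W.Gen :=
  ((PencilPoint.constSub η.ann).submoduleOf P.Lperp).map P.toW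

theorem A_U : ∀ u ∈ η.U, η.A u = 0 := by
  rintro _ ⟨u, hu, rfl⟩
  have h : Matrix.toLin' η.matA (u : Fin N → MeroFun) = 0 := by
    have hu' : (u : Fin N → MeroFun) ∈ PencilPoint.constSub η.ann := hu
    generalize (u : Fin N → MeroFun) = v at hu'
    induction hu' using Submodule.span_induction with
    | mem v hv =>
      obtain ⟨w, hw, rfl⟩ := hv
      apply matA_eq_zero
      · simp only [cst, ← map_mul, ← map_sum]
        rw [hw.1.1, map_zero]
      · simp only [cst, ← map_mul, ← map_sum]
        have := hw.2
        rw [pairing] at this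
        rw [this, map_zero]
    | zero => exact map_zero _
    | add a b _ _ ha hb => rw [map_add, ha, hb, add_zero]
    | smul c a _ ha => rw [map_smul, ha, smul_zero]
  have h2 : (Matrix.toLin' η.matA).restrict (fun u _ => η.matA_mem u) u = (0 : P.Lperp) :=
    Subtype.ext h
  change P.toW ((Matrix.toLin' η.matA).restrict (fun u _ => η.matA_mem u) u) = 0
  rw [h2, map_zero]

/-- The bundle `W / U`. -/
def WU : P1Bundle := P.W.quot η.U

/-- The endomorphism of `W / U` induced by `A`. -/
def AWU : Module.End MeroFun η.WU.Gen :=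
  Submodule.mapQ η.U η.U η.A (by
    intro u hu
    change η.A u ∈ η.U
    rw [η.A_U u hu]
    exact zero_mem _)

/-- The Higgs field `Ψ = A dz` on `W / U`. -/
def Ψ : MeroHiggs η.WU := higgsOf η.WU η.AWU

/-! ### The parabolic Higgs field of rank two -/

/-- The bundle `E = 𝒪(-1) e₁ ⊕ 𝒪 e₂`.  Its sections are the sections of the trivial bundle with
basis `e₁, e₂` whose value at infinity lies in the line spanned by `v₀ = e₂` (the Hecke
transformation of the trivial bundle at infinity along `v₀`). -/
def heckeE : P1Bundle := sumO ![-1, 0]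

/-- The skew form with `⟨e₁, e₂⟩ = 1`. -/
def skew (v w : Fin 2 → MeroFun) : MeroFun := v 0 * w 1 - v 1 * w 0

/-- The endomorphism `v ⊗ v`, that is, `w ↦ ⟨v, w⟩ v`. -/
def sq (v : Fin 2 → MeroFun) : Module.End MeroFun (Fin 2 → MeroFun) where
  toFun w := skew v w • v
  map_add' a b := by
    rw [← add_smul]
    congr 1
    simp only [skew, Pi.add_apply]
    ring
  map_smul' c a := by
    rw [RingHom.id_apply, smul_smul]
    congr 1
    simp only [skew, Pi.smul_apply, smul_eq_mul]
    ring

/-- The vector `v_i = x_i e₁ + y_i e₂`. -/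
def v (i : Fin N) : Fin 2 → MeroFun := ![cst (P.x i), cst (η.y i)]

/-- The coefficient `∑ v_i ⊗ v_i / (z - μ_i)` of `dz` in `Φ`. -/
def gaudin : Module.End MeroFun heckeE.Gen := ∑ i, (zz - cst (P.μ i))⁻¹ • sq (η.v i)

/-- The Higgs field `Φ = ∑ v_i ⊗ v_i / (z - μ_i) dz`. -/
def Φ : MeroHiggs heckeE := higgsOf heckeE η.gaudin

end Covector

end

end PencilHiggs

/-! Everything rests on the map `toHecke` from `W` to `E`, which sends the class of `u` to `∑ uᵢvᵢ =
(∑ xᵢuᵢ, ∑ yᵢuᵢ)`. It kills `L` because `∑ xᵢ² = ∑ xᵢyᵢ = 0`. The equation of `L^⊥` is `z ∑ xᵢuᵢ = ∑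
μᵢxᵢuᵢ`, so for a section regular at infinity the first component has a zero there: this is the
twist `𝒪(-1)` in `E`.

A nonzero cotangent vector makes `x`, `μx`, `y` linearly independent (`Nonzero.exists_values`).
Vectors dual to these three show that the kernel is `U` (`ker_toHecke`) and lift regular sections of
`E` to regular sections of `W` on both charts (`map_toHecke_secFin`, `map_toHecke_secInf`), so that
`W/U ≅ E` as bundles. The map intertwines `A` with the Gaudin matrix (`toHecke_A`), since the
numerator of `(Au)ᵢ` is `⟨vᵢ, ∑ uⱼvⱼ⟩`.

The same independence gives `ker A = U` (`ker_A`), hence rank 2. Skew-adjointness holds because the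
weights `z - μᵢ` of the form cancel the denominators of `A`; the pole of `z² A` at infinity is a
multiple of `x`, hence zero in `W`. -/

namespace PencilHiggs

noncomputable section

variable {N : ℕ}

/-! ### Functionals with constant coefficients. -/

/-- The linear functional `u ↦ ∑ wᵢuᵢ` with constant coefficients. -/
def constFunctional (w : Fin N → ℂ) : (Fin N → MeroFun) →ₗ[MeroFun] MeroFun :=
  ∑ i, cst (w i) • LinearMap.proj i

theorem constFunctional_apply (w : Fin N → ℂ) (u : Fin N → MeroFun) :
    constFunctional w u = ∑ i, cst (w i) * u i := by
  rw [constFunctional, LinearMap.sum_apply]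
  rfl

theorem constFunctional_cst (w t : Fin N → ℂ) :
    constFunctional w (fun i => cst (t i)) = cst (∑ i, w i * t i) := by
  simp only [constFunctional_apply, cst, map_sum, map_mul]

theorem constFunctional_mem (B : Subalgebra ℂ MeroFun) (w : Fin N → ℂ) (u : Fin N → MeroFun)
    (hu : ∀ i, u i ∈ B) : constFunctional w u ∈ B := by
  rw [constFunctional_apply]
  exact sum_mem fun i _ => mul_mem (Subalgebra.algebraMap_mem B _) (hu i)

/-! ### The bundle `W`: its sections and its rank. -/

namespace PencilPoint

variable (P : PencilPoint N)

/-- The functional `u ↦ ∑ xᵢuᵢ`. -/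
abbrev qx : (Fin N → MeroFun) →ₗ[MeroFun] MeroFun := constFunctional P.x

/-- The functional `u ↦ ∑ μᵢxᵢuᵢ`. -/
abbrev q₁x : (Fin N → MeroFun) →ₗ[MeroFun] MeroFun := constFunctional fun i => P.μ i * P.x i

/-- In this form the equation trades `z ∑ xᵢuᵢ` for `∑ μᵢxᵢuᵢ`, which has no factor `z`; all the
regularity statements at infinity use this. -/
theorem mem_Lperp_iff (u : Fin N → MeroFun) : u ∈ P.Lperp ↔ zz * P.qx u = P.q₁x u := by
  rw [mem_Lperp, ← sub_eq_zero (a := zz * P.qx u), constFunctional_apply, constFunctional_apply,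
    Finset.mul_sum, ← Finset.sum_sub_distrib]
  refine Eq.congr_left (Finset.sum_congr rfl fun i _ => ?_)
  simp only [cst, map_mul]
  ring

theorem qx_x : P.qx (fun i => cst (P.x i)) = 0 := by
  rw [constFunctional_cst]
  simp only [← pow_two, P.q_eq_zero, cst, map_zero]

theorem q₁x_x : P.q₁x (fun i => cst (P.x i)) = 0 := by
  rw [constFunctional_cst]
  simp only [mul_assoc, ← pow_two, P.q₁_eq_zero, cst, map_zero]

theorem x_mem_Lperp : (fun i => cst (P.x i)) ∈ P.Lperp := by
  rw [mem_Lperp_iff, qx_x, q₁x_x, mul_zero]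

theorem L_le_Lperp : P.L ≤ P.Lperp := by
  rw [L, Submodule.span_singleton_le_iff_mem]
  exact P.x_mem_Lperp

theorem finrank_L : Module.finrank MeroFun P.L = 1 := by
  refine finrank_span_singleton fun h => P.x_ne_zero (funext fun i => ?_)
  simpa [cst] using congrFun h i

theorem toW_surjective : Function.Surjective P.toW := Submodule.mkQ_surjective _

theorem toW_eq_zero_iff (u : P.Lperp) : P.toW u = 0 ↔ (u : Fin N → MeroFun) ∈ P.L :=
  Submodule.Quotient.mk_eq_zero (P.L.submoduleOf P.Lperp)

theorem toW_mem_secFin {u : P.Lperp} (hu : ∀ i, (u : Fin N → MeroFun) i ∈ regFin) :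
    P.toW u ∈ P.W.secFin := by
  refine ⟨u, fun i => ?_, rfl⟩
  change 1 * (u : Fin N → MeroFun) i ∈ regFin
  simpa using hu i

theorem toW_mem_secInf {u : P.Lperp} (hu : ∀ i, (u : Fin N → MeroFun) i ∈ regInf) :
    P.toW u ∈ P.W.secInf := by
  refine ⟨u, fun i => ?_, rfl⟩
  change zz ^ (-0 : ℤ) * (u : Fin N → MeroFun) i ∈ regInf
  simpa using hu i

theorem exists_of_mem_secFin {w : P.W.Gen} (hw : w ∈ P.W.secFin) :
    ∃ u : P.Lperp, (∀ i, (u : Fin N → MeroFun) i ∈ regFin) ∧ P.toW u = w := by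
  obtain ⟨(u : P.Lperp), hu, rfl⟩ := hw
  refine ⟨u, fun i => ?_, rfl⟩
  have h : 1 * (u : Fin N → MeroFun) i ∈ regFin := hu i
  simpa using h

theorem exists_of_mem_secInf {w : P.W.Gen} (hw : w ∈ P.W.secInf) :
    ∃ u : P.Lperp, (∀ i, (u : Fin N → MeroFun) i ∈ regInf) ∧ P.toW u = w := by
  obtain ⟨(u : P.Lperp), hu, rfl⟩ := hw
  refine ⟨u, fun i => ?_, rfl⟩
  have h : zz ^ (-0 : ℤ) * (u : Fin N → MeroFun) i ∈ regInf := hu i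
  simpa using h

/-- With a single nonzero coordinate, `q` would be its square. -/
theorem exists_two_ne_zero : ∃ i j, i ≠ j ∧ P.x i ≠ 0 ∧ P.x j ≠ 0 := by
  obtain ⟨i, hi⟩ := Function.ne_iff.mp P.x_ne_zero
  by_contra! h
  refine hi ?_
  have := P.q_eq_zero
  rw [Finset.sum_eq_single i (fun j _ hj => by rw [h i j hj.symm hi]; simp) (by simp)] at this
  simpa using this

/-- The functionals `∑ xᵢuᵢ` and `∑ μᵢxᵢuᵢ` take all pairs of values. -/
theorem exists_qx_q₁x (r s : ℂ) :
    ∃ a : Fin N → ℂ, ∑ i, P.x i * a i = r ∧ ∑ i, P.μ i * P.x i * a i = s := by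
  obtain ⟨i, j, hij, hi, hj⟩ := P.exists_two_ne_zero
  have hμ : P.μ i - P.μ j ≠ 0 := sub_ne_zero.mpr fun h => hij (P.μ_injective h)
  -- Solution supported on `i` and `j`: Cramer's rule for the Vandermonde system in the unknowns
  -- `xᵢaᵢ`, `xⱼaⱼ`.
  refine ⟨Pi.single i ((s - P.μ j * r) / (P.μ i - P.μ j) / P.x i)
    + Pi.single j ((P.μ i * r - s) / (P.μ i - P.μ j) / P.x j), ?_, ?_⟩ <;>
  · simp only [Pi.add_apply, mul_add, Finset.sum_add_distrib, Pi.single_apply, mul_ite, mul_zero,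
      Finset.sum_ite_eq', Finset.mem_univ, if_true]
    field_simp
    ring

theorem finrank_W : P.W.rank + 2 = N := by
  -- One nonzero equation cuts out `L^⊥`, and the quotient by `L` loses one more dimension.
  have hker : P.Lperp = LinearMap.ker (zz • P.qx - P.q₁x) := by
    ext u
    rw [mem_Lperp_iff, LinearMap.mem_ker, LinearMap.sub_apply, sub_eq_zero]
    rfl
  obtain ⟨a, ha, ha'⟩ := P.exists_qx_q₁x 0 1
  have hne : zz • P.qx - P.q₁x ≠ 0 := by
    intro h
    have := LinearMap.congr_fun h fun i => cst (a i)
    rw [LinearMap.sub_apply, LinearMap.smul_apply, constFunctional_cst, constFunctional_cst, ha,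
      ha'] at this
    simp [cst] at this
  have h1 := Module.Dual.finrank_ker_add_one_of_ne_zero hne
  rw [← hker, Module.finrank_fin_fun] at h1
  have h2 := Submodule.finrank_quotient_add_finrank (P.L.submoduleOf P.Lperp)
  rw [(Submodule.submoduleOfEquivOfLe P.L_le_Lperp).finrank_eq, finrank_L] at h2
  have h3 : P.W.rank = Module.finrank MeroFun (P.Lperp ⧸ P.L.submoduleOf P.Lperp) := rfl
  omega

end PencilPoint

/-! ### Skew-adjointness of `A` and independence of the representative. -/

namespace Covector

variable {P : PencilPoint N} (η : Covector P)

/-- The functional `u ↦ ∑ yᵢuᵢ`. -/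
abbrev qy : (Fin N → MeroFun) →ₗ[MeroFun] MeroFun := constFunctional η.y

theorem qy_x : η.qy (fun i => cst (P.x i)) = 0 := by
  rw [constFunctional_cst, Finset.sum_congr rfl fun i _ => mul_comm _ _, η.orth, cst, map_zero]

theorem sub_mul_matA (u : Fin N → MeroFun) (i : Fin N) :
    (zz - cst (P.μ i)) * Matrix.toLin' η.matA u i
      = cst (P.x i) * η.qy u - cst (η.y i) * P.qx u := by
  rw [matA_apply, mul_div_cancel₀ _ (zz_sub_ne_zero _), constFunctional_apply,
    constFunctional_apply]

theorem A_toW (u : P.Lperp) : η.A (P.toW u) = P.toW ⟨Matrix.toLin' η.matA u, η.matA_mem u⟩ := rfl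

theorem formW_toW (u v : P.Lperp) : P.formW (P.toW u) (P.toW v) = P.form u v := rfl

/-- The weight `z - μᵢ` of the form cancels the denominator of row `i`; what remains is visibly
antisymmetric in `u` and `v`. -/
theorem form_matA (u v : Fin N → MeroFun) :
    P.form (Matrix.toLin' η.matA u) v = η.qy u * P.qx v - P.qx u * η.qy v := by
  rw [PencilPoint.form_apply, constFunctional_apply P.x v, constFunctional_apply η.y v,
    Finset.mul_sum, Finset.mul_sum, ← Finset.sum_sub_distrib]
  refine Finset.sum_congr rfl fun i _ => ?_
  rw [sub_mul_matA]
  ring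

theorem formW_A (u v : P.W.Gen) : P.formW (η.A u) v = -P.formW u (η.A v) := by
  obtain ⟨u, rfl⟩ := P.toW_surjective u
  obtain ⟨v, rfl⟩ := P.toW_surjective v
  rw [A_toW, A_toW, formW_toW, formW_toW, PencilPoint.form_comm P u, form_matA, form_matA]
  ring

/-- Two representatives of the same cotangent vector differ by a combination of `x` and `μx`. -/
theorem SameCotangent.exists_eq {η η' : Covector P} (h : η.SameCotangent η') :
    ∃ α β : ℂ, ∀ i, η'.y i = η.y i + α * P.x i + β * (P.μ i * P.x i) := by
  obtain ⟨a, ha, ha'⟩ := P.exists_qx_q₁x 1 0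
  obtain ⟨b, hb, hb'⟩ := P.exists_qx_q₁x 0 1
  refine ⟨η'.pairing a - η.pairing a, η'.pairing b - η.pairing b, fun i => ?_⟩
  -- With `a`, `b` dual to the functionals given by `x` and `μx`, this is the projection of the
  -- `i`-th basis vector to the tangent space; evaluating both covectors on it isolates `yᵢ`.
  have hmem : (Pi.single i 1 - P.x i • a - (P.μ i * P.x i) • b : Fin N → ℂ) ∈ P.tangent := by
    constructor <;>
      simp [mul_sub, Pi.single_apply, mul_left_comm _ (P.x i), mul_left_comm _ (P.μ i * P.x i),
        ← Finset.mul_sum, ha, ha', hb, hb']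
  have := h _ hmem
  have key : ∀ θ : Covector P, θ.pairing (Pi.single i 1 - P.x i • a - (P.μ i * P.x i) • b)
      = θ.y i - P.x i * θ.pairing a - (P.μ i * P.x i) * θ.pairing b := by
    intro θ
    simp [pairing, mul_sub, Pi.single_apply, mul_left_comm _ (P.x i),
      mul_left_comm _ (P.μ i * P.x i), ← Finset.mul_sum]
  rw [key, key] at this
  linear_combination -this

/-- Adding `αx` to `y` leaves the matrix unchanged by antisymmetry. Adding `βμx` changes `Au` by `β
(∑ xⱼuⱼ) x` for `u` in `L^⊥`, which vanishes modulo `L`. -/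
theorem SameCotangent.A_eq {η η' : Covector P} (h : η.SameCotangent η') : η'.A = η.A := by
  obtain ⟨α, β, hαβ⟩ := h.exists_eq
  ext w
  obtain ⟨u, rfl⟩ := P.toW_surjective w
  rw [A_toW, A_toW, ← sub_eq_zero, ← map_sub, PencilPoint.toW_eq_zero_iff]
  refine Submodule.mem_span_singleton.mpr ⟨cst β * P.qx u, funext fun i => ?_⟩
  have hu := (P.mem_Lperp_iff u).mp u.2
  have hqy : η'.qy u = η.qy u + cst α * P.qx u + cst β * P.q₁x u := by
    simp only [constFunctional_apply, hαβ, Finset.mul_sum, ← Finset.sum_add_distrib]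
    refine Finset.sum_congr rfl fun j _ => ?_
    simp only [cst, map_add, map_mul]
    ring
  refine mul_left_cancel₀ (zz_sub_ne_zero (P.μ i)) ?_
  change _ = (zz - cst (P.μ i)) * (Matrix.toLin' η'.matA u i - Matrix.toLin' η.matA u i)
  rw [mul_sub, sub_mul_matA, sub_mul_matA, hqy, ← hu, hαβ]
  simp only [cst, map_add, map_mul, Pi.smul_apply, smul_eq_mul]
  ring

/-! ### The poles of `A dz`. -/

theorem prod_smul_A_mem_secFin {w : P.W.Gen} (hw : w ∈ P.W.secFin) :
    (∏ i, (zz - cst (P.μ i))) • η.A w ∈ P.W.secFin := by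
  obtain ⟨u, hu, rfl⟩ := P.exists_of_mem_secFin hw
  rw [A_toW, ← map_smul]
  refine P.toW_mem_secFin fun i => ?_
  change (∏ i, (zz - cst (P.μ i))) * Matrix.toLin' η.matA u i ∈ regFin
  -- Row `i` has its only pole at `μᵢ`, so the factor of index `i` alone clears it.
  rw [← Finset.mul_prod_erase _ _ (Finset.mem_univ i), mul_right_comm, sub_mul_matA]
  have hc := Subalgebra.algebraMap_mem regFin
  exact mul_mem (sub_mem (mul_mem (hc _) (constFunctional_mem _ _ _ hu))
    (mul_mem (hc _) (constFunctional_mem _ _ _ hu)))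
    (prod_mem fun j _ => sub_mem zz_mem (hc _))

/-- A product of functions `1 - aⱼ/z` equals `1` at infinity. -/
theorem zz_mul_prod_sub_one_mem {ι : Type*} (s : Finset ι) (a : ι → ℂ) :
    zz * (∏ j ∈ s, (1 - cst (a j) * zz⁻¹) - 1) ∈ regInf := by
  classical
  have hc := Subalgebra.algebraMap_mem regInf
  induction s using Finset.induction_on with
  | empty => simp
  | insert i s hi ih =>
    rw [Finset.prod_insert hi]
    have h : zz * ((1 - cst (a i) * zz⁻¹) * ∏ j ∈ s, (1 - cst (a j) * zz⁻¹) - 1)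
        = zz * (∏ j ∈ s, (1 - cst (a j) * zz⁻¹) - 1)
          - cst (a i) * ∏ j ∈ s, (1 - cst (a j) * zz⁻¹) := by
      have := zz_ne_zero
      generalize ∏ j ∈ s, (1 - cst (a j) * zz⁻¹) = p
      field_simp
      ring
    rw [h]
    exact sub_mem ih (mul_mem (hc _)
      (prod_mem fun j _ => sub_mem (one_mem _) (mul_mem (hc _) zz_inv_mem)))

/-- At infinity `z² Au` has the polar part `z (∑ yⱼuⱼ) x`, a section of `L`, so another
representative of the class is regular. The term with `yᵢ` causes no pole, because `z ∑ xⱼuⱼ = ∑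
μⱼxⱼuⱼ` on `L^⊥`. -/
theorem sq_prod_smul_A_mem_secInf {w : P.W.Gen} (hw : w ∈ P.W.secInf) :
    (zz ^ 2 * ∏ i, (1 - cst (P.μ i) * zz⁻¹)) • η.A w ∈ P.W.secInf := by
  obtain ⟨u, hu, rfl⟩ := P.exists_of_mem_secInf hw
  have hz := zz_ne_zero
  set p : MeroFun := ∏ i, (1 - cst (P.μ i) * zz⁻¹) with hp
  let x' : P.Lperp := ⟨fun i => cst (P.x i), P.x_mem_Lperp⟩
  have hx' : P.toW x' = 0 :=
    (P.toW_eq_zero_iff _).mpr (Submodule.mem_span_singleton_self _)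
  have e : (zz ^ 2 * p) • η.A (P.toW u) = P.toW ((zz ^ 2 * p) •
      (⟨Matrix.toLin' η.matA u, η.matA_mem u⟩ : P.Lperp) - (zz * η.qy u) • x') := by
    rw [map_sub, map_smul, map_smul, hx', smul_zero, sub_zero, A_toW]
  rw [e]
  refine P.toW_mem_secInf fun i => ?_
  change zz ^ 2 * p * Matrix.toLin' η.matA u i - zz * η.qy u * cst (P.x i) ∈ regInf
  set r : MeroFun := ∏ j ∈ Finset.univ.erase i, (1 - cst (P.μ j) * zz⁻¹) with hr
  have hpr : zz * p = (zz - cst (P.μ i)) * r := by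
    rw [hp, ← Finset.mul_prod_erase _ _ (Finset.mem_univ i), ← hr]
    field_simp
  -- After the factor of index `i` cancels, the subtraction turns `z r` into `z (r - 1)`, which is
  -- regular since `r = 1` at infinity.
  have e2 : zz ^ 2 * p * Matrix.toLin' η.matA u i - zz * η.qy u * cst (P.x i)
      = cst (P.x i) * η.qy u * (zz * (r - 1)) - cst (η.y i) * P.q₁x u * r := by
    linear_combination zz * Matrix.toLin' η.matA u i * hpr + zz * r * η.sub_mul_matA u i
      - cst (η.y i) * r * (P.mem_Lperp_iff u).mp u.2
  rw [e2]
  have hc := Subalgebra.algebraMap_mem regInf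
  exact sub_mem (mul_mem (mul_mem (hc _) (constFunctional_mem _ _ _ hu))
      (zz_mul_prod_sub_one_mem _ _))
    (mul_mem (mul_mem (hc _) (constFunctional_mem _ _ _ hu))
      (prod_mem fun j _ => sub_mem (one_mem _) (mul_mem (hc _) zz_inv_mem)))

theorem hasSimplePoles_A : HasSimplePoles P.μ P.W η.A :=
  ⟨fun _ => η.prod_smul_A_mem_secFin, fun _ => η.sq_prod_smul_A_mem_secInf⟩

/-! ### Consequences of a nonzero cotangent vector: the kernels of `toHecke` and `A`. -/

/-- If the cotangent vector does not vanish, the functionals `∑ xᵢuᵢ`, `∑ μᵢxᵢuᵢ` and `∑ yᵢuᵢ`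
take all triples of values. -/
theorem Nonzero.exists_values {η : Covector P} (hη : η.Nonzero) (r s t : ℂ) :
    ∃ a : Fin N → ℂ, ∑ i, P.x i * a i = r ∧ ∑ i, P.μ i * P.x i * a i = s ∧
      ∑ i, η.y i * a i = t := by
  obtain ⟨c, ⟨hc, hc'⟩, hy⟩ := hη
  obtain ⟨a, ha, ha'⟩ := P.exists_qx_q₁x r s
  rw [pairing] at hy
  -- Moving along the tangent vector `c` corrects the third value without touching the first two.
  set k := (t - ∑ i, η.y i * a i) / ∑ i, η.y i * c i with hk
  refine ⟨a + k • c, ?_, ?_, ?_⟩ <;>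
    simp only [Pi.add_apply, Pi.smul_apply, smul_eq_mul, mul_add, Finset.sum_add_distrib,
      mul_left_comm _ k, ← Finset.mul_sum]
  · rw [ha, hc, mul_zero, add_zero]
  · rw [ha', hc', mul_zero, add_zero]
  · rw [hk, div_mul_cancel₀ _ hy]
    ring

theorem Nonzero.mem_constSub_ann {η : Covector P} (hη : η.Nonzero) {u : Fin N → MeroFun}
    (h0 : P.qx u = 0) (h1 : P.q₁x u = 0) (h2 : η.qy u = 0) :
    u ∈ PencilPoint.constSub η.ann := by
  obtain ⟨a, ha, ha', ha''⟩ := hη.exists_values 1 0 0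
  obtain ⟨b, hb, hb', hb''⟩ := hη.exists_values 0 1 0
  obtain ⟨c, hc, hc', hc''⟩ := hη.exists_values 0 0 1
  -- Projection of the `j`-th basis vector to the common kernel of the three functionals, along the
  -- dual vectors `a`, `b`, `c`. In `∑ uⱼdⱼ` the corrections add up to multiples of the three values
  -- at `u`, which are zero.
  let d : Fin N → Fin N → ℂ := fun j =>
    Pi.single j 1 - P.x j • a - (P.μ j * P.x j) • b - η.y j • c
  have hd : ∀ j, d j ∈ η.ann := by
    intro j
    refine ⟨⟨?_, ?_⟩, ?_⟩ <;>
      simp [d, pairing, mul_sub, Pi.single_apply, mul_left_comm _ (P.x j),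
        mul_left_comm _ (P.μ j * P.x j), mul_left_comm _ (η.y j), ← Finset.mul_sum, ha, ha', ha'',
        hb, hb', hb'', hc, hc', hc'']
  have hu : u = ∑ j, u j • fun i => cst (d j i) := by
    ext i
    have h : ∀ j, u j * cst (d j i) = u j * cst ((Pi.single j 1 : Fin N → ℂ) i)
        - cst (a i) * (cst (P.x j) * u j) - cst (b i) * (cst (P.μ j * P.x j) * u j)
        - cst (c i) * (cst (η.y j) * u j) := by
      intro j
      simp only [d, cst, Pi.sub_apply, Pi.smul_apply, smul_eq_mul, map_sub, map_mul]
      ring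
    rw [Finset.sum_apply]
    simp only [Pi.smul_apply, smul_eq_mul, h, Finset.sum_sub_distrib, ← Finset.mul_sum]
    rw [← constFunctional_apply, ← constFunctional_apply, ← constFunctional_apply, h0, h1, h2]
    simp [cst, Pi.single_apply, apply_ite]
  rw [hu]
  exact sum_mem fun j _ => Submodule.smul_mem _ _ (Submodule.subset_span ⟨d j, hd j, rfl⟩)

/-- The map `W → E` which sends the class of `u` to `∑ uᵢvᵢ`. -/
def toHecke : P.W.Gen →ₗ[MeroFun] heckeE.Gen :=
  (P.L.submoduleOf P.Lperp).liftQ (LinearMap.pi ![P.qx, η.qy] ∘ₗ P.Lperp.subtype) (by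
    intro u hu
    obtain ⟨c, hc⟩ := Submodule.mem_span_singleton.mp (show (u : Fin N → MeroFun) ∈ P.L from hu)
    have h : LinearMap.pi ![P.qx, η.qy] (u : Fin N → MeroFun) = 0 := by
      rw [← hc, map_smul]
      ext i
      fin_cases i
      · exact (congrArg _ P.qx_x).trans (mul_zero c)
      · exact (congrArg _ η.qy_x).trans (mul_zero c)
    exact h)

theorem toHecke_toW (u : P.Lperp) : η.toHecke (P.toW u) = ![P.qx u, η.qy u] := by
  change LinearMap.pi ![P.qx, η.qy] (u : Fin N → MeroFun) = _
  ext i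
  fin_cases i <;> rfl

/-- On `L^⊥` the condition `∑ μᵢxᵢuᵢ = 0` follows from `∑ xᵢuᵢ = 0`, so two equations suffice. -/
theorem mem_U_of_qx_of_qy {η : Covector P} (hη : η.Nonzero) {u : P.Lperp} (h0 : P.qx u = 0)
    (h2 : η.qy u = 0) : P.toW u ∈ η.U := by
  refine ⟨u, hη.mem_constSub_ann h0 ?_ h2, rfl⟩
  change P.q₁x u = 0
  rw [← (P.mem_Lperp_iff u).mp u.2, h0, mul_zero]

theorem toHecke_eq_zero_of_mem_U {w : P.W.Gen} (hw : w ∈ η.U) : η.toHecke w = 0 := by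
  obtain ⟨u, hu, rfl⟩ := hw
  have hu' : (u : Fin N → MeroFun) ∈ PencilPoint.constSub η.ann := hu
  have h : P.qx u = 0 ∧ η.qy u = 0 := by
    have hle : PencilPoint.constSub η.ann ≤ LinearMap.ker P.qx ⊓ LinearMap.ker η.qy := by
      rw [PencilPoint.constSub, Submodule.span_le]
      rintro _ ⟨t, ⟨⟨ht, _⟩, ht'⟩, rfl⟩
      rw [pairing] at ht'
      constructor <;> rw [SetLike.mem_coe, LinearMap.mem_ker, constFunctional_cst]
      · rw [ht, cst, map_zero]
      · rw [ht', cst, map_zero]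
    exact hle hu'
  rw [toHecke_toW, h.1, h.2]
  exact funext fun i => by fin_cases i <;> rfl

theorem ker_toHecke {η : Covector P} (hη : η.Nonzero) : LinearMap.ker η.toHecke = η.U := by
  refine le_antisymm (fun w hw => ?_) fun w hw => η.toHecke_eq_zero_of_mem_U hw
  obtain ⟨u, rfl⟩ := P.toW_surjective w
  rw [LinearMap.mem_ker, toHecke_toW] at hw
  exact mem_U_of_qx_of_qy hη (congrFun hw 0) (congrFun hw 1)

/-- If `Au = kx`, clearing denominators gives `k (zx - μx) = (∑ yⱼuⱼ) x - (∑ xⱼuⱼ) y`. By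
independence of `x`, `μx`, `y`, all coefficients vanish. -/
theorem ker_A {η : Covector P} (hη : η.Nonzero) : LinearMap.ker η.A = η.U := by
  refine le_antisymm (fun w hw => ?_) fun w hw => η.A_U w hw
  obtain ⟨u, rfl⟩ := P.toW_surjective w
  rw [LinearMap.mem_ker, A_toW, PencilPoint.toW_eq_zero_iff] at hw
  obtain ⟨k, hk⟩ := Submodule.mem_span_singleton.mp hw
  -- The vector identity paired with a constant vector `t`; the dual vectors `a`, `b`, `c` then read
  -- off the coefficients of `x`, `μx`, `y`.
  have key : ∀ t : Fin N → ℂ, k * (zz * cst (∑ i, P.x i * t i) - cst (∑ i, P.μ i * P.x i * t i))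
      = cst (∑ i, P.x i * t i) * η.qy u - cst (∑ i, η.y i * t i) * P.qx u := by
    intro t
    have h : ∀ i, cst (t i) * ((zz - cst (P.μ i)) * (k * cst (P.x i)))
        = cst (t i) * (cst (P.x i) * η.qy u - cst (η.y i) * P.qx u) := by
      intro i
      rw [← sub_mul_matA]
      exact congrArg (fun f : Fin N → MeroFun => cst (t i) * ((zz - cst (P.μ i)) * f i)) hk
    simp only [cst, map_sum, map_mul, Finset.mul_sum, Finset.sum_mul, ← Finset.sum_sub_distrib]
    refine (Finset.sum_congr rfl fun i _ => ?_).trans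
      ((Finset.sum_congr rfl fun i _ => h i).trans (Finset.sum_congr rfl fun i _ => ?_)) <;>
    · simp only [cst]
      ring
  obtain ⟨a, ha, ha', ha''⟩ := hη.exists_values 1 0 0
  obtain ⟨b, hb, hb', hb''⟩ := hη.exists_values 0 1 0
  obtain ⟨c, hc, hc', hc''⟩ := hη.exists_values 0 0 1
  have h1 := key a
  have h2 := key b
  have h3 := key c
  simp only [ha, ha', ha'', cst, map_one, map_zero] at h1
  simp only [hb, hb', hb'', cst, map_one, map_zero] at h2
  simp only [hc, hc', hc'', cst, map_one, map_zero] at h3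
  have hk0 : k = 0 := by linear_combination -h2
  subst hk0
  exact mem_U_of_qx_of_qy hη (by linear_combination h3) (by linear_combination -h1)

theorem U_eq {η : Covector P} (hη : η.Nonzero) : η.U = P.T ⊓ LinearMap.ker η.A := by
  rw [ker_A hη, eq_comm, inf_eq_right]
  refine Submodule.map_mono (Submodule.comap_mono (Submodule.span_mono (Set.image_mono ?_)))
  exact fun u hu => hu.1

/-! ### Lifting sections of `E` to `W`. -/

/-- Every pair `(f, g)` is `(∑ xᵢuᵢ, ∑ yᵢuᵢ)` for a section `u` of `L^⊥` whose components are
constant combinations of `f`, `zf` and `g`. -/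
theorem Nonzero.exists_lift {η : Covector P} (hη : η.Nonzero) (f g : MeroFun) :
    ∃ u : P.Lperp, P.qx u = f ∧ η.qy u = g ∧ ∀ B : Subalgebra ℂ MeroFun,
      f ∈ B → zz * f ∈ B → g ∈ B → ∀ i, (u : Fin N → MeroFun) i ∈ B := by
  obtain ⟨a, ha, ha', ha''⟩ := hη.exists_values 1 0 0
  obtain ⟨b, hb, hb', hb''⟩ := hη.exists_values 0 1 0
  obtain ⟨c, hc, hc', hc''⟩ := hη.exists_values 0 0 1
  -- The coefficient `zf` is forced: it is the value of `∑ μᵢxᵢuᵢ` that places `u` in `L^⊥`.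
  let u : Fin N → MeroFun := f • (fun i => cst (a i)) + (zz * f) • (fun i => cst (b i))
    + g • fun i => cst (c i)
  have hx : P.qx u = f := by
    simp only [u, map_add, map_smul, constFunctional_cst, ha, hb, hc, cst, map_one, map_zero]
    simp
  have hμ : P.q₁x u = zz * f := by
    simp only [u, map_add, map_smul, constFunctional_cst, ha', hb', hc', cst, map_one, map_zero]
    simp
  have hy : η.qy u = g := by
    simp only [u, map_add, map_smul, constFunctional_cst, ha'', hb'', hc'', cst, map_one, map_zero]
    simp
  refine ⟨⟨u, (P.mem_Lperp_iff u).mpr (by rw [hx, hμ])⟩, hx, hy, fun B h1 h2 h3 i => ?_⟩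
  have hB := Subalgebra.algebraMap_mem B
  exact add_mem (add_mem (mul_mem h1 (hB _)) (mul_mem h2 (hB _))) (mul_mem h3 (hB _))

theorem toHecke_surjective {η : Covector P} (hη : η.Nonzero) : Function.Surjective η.toHecke := by
  intro p
  obtain ⟨u, h1, h2, -⟩ := hη.exists_lift (p 0) (p 1)
  refine ⟨P.toW u, ?_⟩
  rw [toHecke_toW, h1, h2]
  exact funext fun i => by fin_cases i <;> rfl

theorem mem_heckeE_secFin (p : heckeE.Gen) : p ∈ heckeE.secFin ↔ p 0 ∈ regFin ∧ p 1 ∈ regFin := by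
  change (∀ i, 1 * p i ∈ regFin) ↔ _
  simp only [one_mul, Fin.forall_fin_two]

theorem mem_heckeE_secInf (p : heckeE.Gen) :
    p ∈ heckeE.secInf ↔ zz * p 0 ∈ regInf ∧ p 1 ∈ regInf := by
  change (∀ i, zz ^ (-(![-1, 0] : Fin 2 → ℤ) i) * p i ∈ regInf) ↔ _
  rw [Fin.forall_fin_two]
  simp

/-- The map `W → E` is surjective on regular sections over `z ≠ ∞`. -/
theorem map_toHecke_secFin {η : Covector P} (hη : η.Nonzero) (p : heckeE.Gen) :
    p ∈ heckeE.secFin ↔ ∃ w ∈ P.W.secFin, η.toHecke w = p := by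
  constructor
  · intro hp
    obtain ⟨h0, h1⟩ := (mem_heckeE_secFin p).mp hp
    obtain ⟨u, hx, hy, hu⟩ := hη.exists_lift (p 0) (p 1)
    refine ⟨_, P.toW_mem_secFin (hu _ h0 (mul_mem zz_mem h0) h1), ?_⟩
    rw [toHecke_toW, hx, hy]
    exact funext fun i => by fin_cases i <;> rfl
  · rintro ⟨w, hw, rfl⟩
    obtain ⟨u, hu, rfl⟩ := P.exists_of_mem_secFin hw
    rw [toHecke_toW]
    exact (mem_heckeE_secFin _).mpr
      ⟨constFunctional_mem _ _ _ hu, constFunctional_mem _ _ _ hu⟩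

/-- The map `W → E` is surjective on regular sections over `z ≠ 0`. -/
theorem map_toHecke_secInf {η : Covector P} (hη : η.Nonzero) (p : heckeE.Gen) :
    p ∈ heckeE.secInf ↔ ∃ w ∈ P.W.secInf, η.toHecke w = p := by
  constructor
  · intro hp
    obtain ⟨h0, h1⟩ := (mem_heckeE_secInf p).mp hp
    obtain ⟨u, hx, hy, hu⟩ := hη.exists_lift (p 0) (p 1)
    -- The lift needs `f`, `zf` and `g` regular; the twist `𝒪(-1)` provides `zf`, and `f` is `z⁻¹`
    -- times it.
    have h0' : p 0 ∈ regInf := by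
      have := mul_mem zz_inv_mem h0
      rwa [inv_mul_cancel_left₀ zz_ne_zero] at this
    refine ⟨_, P.toW_mem_secInf (hu _ h0' h0 h1), ?_⟩
    rw [toHecke_toW, hx, hy]
    exact funext fun i => by fin_cases i <;> rfl
  · rintro ⟨w, hw, rfl⟩
    obtain ⟨u, hu, rfl⟩ := P.exists_of_mem_secInf hw
    rw [toHecke_toW]
    refine (mem_heckeE_secInf _).mpr ⟨?_, constFunctional_mem _ _ _ hu⟩
    change zz * P.qx u ∈ regInf
    rw [(P.mem_Lperp_iff u).mp u.2]
    exact constFunctional_mem _ _ _ hu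

/-! ### The isomorphism `W/U ≅ E` and the Higgs fields. -/

/-- For `p = ∑ uⱼvⱼ` the number `⟨vᵢ, p⟩ = xᵢ ∑ yⱼuⱼ - yᵢ ∑ xⱼuⱼ` is the numerator of `(Au)ᵢ`, so `∑
(Au)ᵢvᵢ` is the Gaudin sum applied to `p`. -/
theorem toHecke_A (w : P.W.Gen) : η.toHecke (η.A w) = η.gaudin (η.toHecke w) := by
  obtain ⟨u, rfl⟩ := P.toW_surjective w
  have hsum : ∀ (p : Fin 2 → MeroFun) (j : Fin 2), (η.gaudin p : Fin 2 → MeroFun) j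
      = ∑ i, (zz - cst (P.μ i))⁻¹ * (skew (η.v i) p * η.v i j) := by
    intro p j
    have : (η.gaudin p : Fin 2 → MeroFun)
        = ∑ i, (zz - cst (P.μ i))⁻¹ • skew (η.v i) p • η.v i := by
      change (∑ i, (zz - cst (P.μ i))⁻¹ • sq (η.v i) : Module.End MeroFun (Fin 2 → MeroFun)) p = _
      rw [LinearMap.sum_apply]
      rfl
    rw [this, Finset.sum_apply]
    rfl
  have hA : ∀ i, Matrix.toLin' η.matA u i
      = (zz - cst (P.μ i))⁻¹ * (cst (P.x i) * η.qy u - cst (η.y i) * P.qx u) := fun i => by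
    rw [← sub_mul_matA, inv_mul_cancel_left₀ (zz_sub_ne_zero _)]
  rw [A_toW, toHecke_toW, toHecke_toW]
  refine funext fun j => ?_
  refine Eq.trans ?_ (hsum _ j).symm
  fin_cases j
  · refine (constFunctional_apply _ _).trans (Finset.sum_congr rfl fun i _ => ?_)
    change cst (P.x i) * Matrix.toLin' η.matA u i = (zz - cst (P.μ i))⁻¹ *
      ((cst (P.x i) * η.qy u - cst (η.y i) * P.qx u) * cst (P.x i))
    rw [hA]
    ring
  · refine (constFunctional_apply _ _).trans (Finset.sum_congr rfl fun i _ => ?_)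
    change cst (η.y i) * Matrix.toLin' η.matA u i = (zz - cst (P.μ i))⁻¹ *
      ((cst (P.x i) * η.qy u - cst (η.y i) * P.qx u) * cst (η.y i))
    rw [hA]
    ring

/-- The isomorphism `W / U ≅ E` of the spaces of meromorphic sections. -/
def heckeEquiv {η : Covector P} (hη : η.Nonzero) : η.WU.Gen ≃ₗ[MeroFun] heckeE.Gen :=
  LinearEquiv.ofBijective (η.U.liftQ η.toHecke (ker_toHecke hη).ge)
    ⟨LinearMap.ker_eq_bot.mp (Submodule.ker_liftQ_eq_bot _ _ _ (ker_toHecke hη).le),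
      fun p => (toHecke_surjective hη p).imp' η.U.mkQ fun _ h => h⟩

/-- The isomorphism of vector bundles `W / U ≅ E`. -/
def heckeIso {η : Covector P} (hη : η.Nonzero) : η.WU.Iso heckeE where
  toEquiv := heckeEquiv hη
  map_fin p := by
    -- Regular sections of `W/U` are by definition the classes of regular sections of `W`, so
    -- injectivity reduces the claim to the image of the latter in `E`.
    rw [map_toHecke_secFin hη]
    constructor
    · rintro ⟨w, hw, rfl⟩
      exact ⟨w, hw, rfl⟩
    · rintro ⟨w, hw, h⟩
      exact ⟨w, hw, (heckeEquiv hη).injective h⟩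
  map_inf p := by
    rw [map_toHecke_secInf hη]
    constructor
    · rintro ⟨w, hw, rfl⟩
      exact ⟨w, hw, rfl⟩
    · rintro ⟨w, hw, h⟩
      exact ⟨w, hw, (heckeEquiv hη).injective h⟩

theorem higgsEquivalent {η : Covector P} (hη : η.Nonzero) : HiggsEquivalent η.Ψ η.Φ := by
  refine ⟨heckeIso hη, fun p => ?_⟩
  obtain ⟨w, rfl⟩ := η.U.mkQ_surjective p
  exact congrArg (fun f : heckeE.Gen => f ⊗ₜ[MeroFun] KaehlerDifferential.D ℂ MeroFun zz)
    (η.toHecke_A w)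

theorem rank_WU {η : Covector P} (hη : η.Nonzero) : η.WU.rank = 2 :=
  (heckeEquiv hη).finrank_eq.trans (Module.finrank_fin_fun MeroFun)

/-- The image of `A` is `W / ker A = W/U`. -/
theorem finrank_range_A {η : Covector P} (hη : η.Nonzero) :
    Module.finrank MeroFun (LinearMap.range η.A) = 2 := by
  rw [← η.A.quotKerEquivRange.finrank_eq, ker_A hη]
  exact rank_WU hη

end Covector

end

end PencilHiggs

theorem mainTheorem3 {N : ℕ} (P : PencilHiggs.PencilPoint N) (η : PencilHiggs.Covector P)
    (hη : η.Nonzero) :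
    P.W.rank + 2 = N ∧
    (∀ η' : PencilHiggs.Covector P, η.SameCotangent η' → η'.A = η.A) ∧
    (∀ u v : P.W.Gen, P.formW (η.A u) v = -P.formW u (η.A v)) ∧
    Module.finrank PencilHiggs.MeroFun (LinearMap.range η.A) = 2 ∧
    PencilHiggs.HasSimplePoles P.μ P.W η.A ∧
    η.U = P.T ⊓ LinearMap.ker η.A ∧
    η.WU.rank = 2 ∧
    PencilHiggs.HiggsEquivalent η.Ψ η.Φ :=
  ⟨P.finrank_W, fun _ h => h.A_eq, η.formW_A, PencilHiggs.Covector.finrank_range_A hη,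
    η.hasSimplePoles_A, PencilHiggs.Covector.U_eq hη, PencilHiggs.Covector.rank_WU hη,
    PencilHiggs.Covector.higgsEquivalent hη⟩
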